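/- Let $(\Omega,\mathcal F)$ be a measurable space, let $E$ be a non-empty Borel space (a topological space homeomorphic to a Borel subset of a Polish space) with Borel $\sigma$-field $\mathcal E$, let $A\in\mathcal F\otimes\mathcal E$, and let $f:\Omega\times E\to[-\infty,\infty]$ be $\mathcal F\otimes\mathcal E$-measurable (for example real-valued). For a probability measure $\mathbb P$ on $(\Omega,\mathcal F)$ let $\mathcal F^{\mathbb P}$ be the $\sigma$-field generated by $\mathcal F$ and the sets of $\mathbb P$-outer measure zero, and let $\mathcal F^U=\bigcap_{\mathbb P}\mathcal F^{\mathbb P}$, over all probability measures $\mathbb P$ on $(\Omega,\mathcal F)$, be the universal completion of $\mathcal F$. Write $A^\omega=\{x\in E:(\omega,x)\in A\}$, $\pi_\Omega(A)=\{\omega: A^\omega\neq\emptyset\}$ and, for $\varepsilon>0$, $$g(\omega)=\sup\{f(\omega,x):(\omega,x)\in A\}\quad(\sup\emptyset=-\infty),\qquad g^\varepsilon(\omega)=\begin{cases} g(\omega)-\varepsilon, & g(\omega)<\infty,\\ 1/\varepsilon, & g(\omega)=\infty.\end{cases}$$ (i) The function $g:\Omega\to[-\infty,\infty]$ is $\mathcal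 F^U$-measurable and $\pi_\Omega(A)\in\mathcal F^U$. Moreover, for every $\varepsilon>0$ there is an $\mathcal F^U$-measurable map $Z_\varepsilon:\Omega\to E$ such that, for every $\omega\in\pi_\Omega(A)$, $$Z_\varepsilon(\omega)\in A^\omega\quad\text{and}\quad f(\omega,Z_\varepsilon(\omega))\ge g^\varepsilon(\omega).$$ (ii) For every probability measure $\mathbb P$ on $(\Omega,\mathcal F)$, $$\mathbb E^{\mathbb P}\big[g\,1_{\pi_\Omega(A)}\big]=\sup\Big\{\mathbb E^{\mathbb P}\big[f(\omega,Z(\omega))1_{\pi_\Omega(A)}(\omega)\big]\;:\;Z:\Omega\to E\ \ \mathcal F\text{-measurable},\ Z(\omega)\in A^\omega\text{ for }\mathbb P\text{-a.e. }\omega\in\pi_\Omega(A)\Big\}.$$ Here $\mathbb E^{\mathbb P}[X]=\mathbb E^{\mathbb P}[X^+]-\mathbb E^{\mathbb P}[X^-]\in[-\infty,\infty]$ with the convention $\infty-\infty=-\infty$, and the products with $1_{\pi_\Omega(A)}$ are $0$ outside $\pi_\Omega(A)$. -/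

import Mathlib

open MeasureTheory Set
open scoped ENNReal

universe u v

/-- A topological space is a Borel space if it is homeomorphic to a Borel subset of a Polish
space. -/
def IsBorelTopSpace (E : Type v) [TopologicalSpace E] : Prop :=
  ∃ (X : Type v) (_ : TopologicalSpace X) (_ : PolishSpace X) (s : Set X),
    MeasurableSet[borel X] s ∧ Nonempty (E ≃ₜ s)

section Completion

variable {Ω : Type u} [mΩ : MeasurableSpace Ω]

/-- The completion of the σ-field of `Ω` with respect to `P`: the sets that differ from a measurable
set by a `P`-negligible set. -/
abbrev completionField (P : Measure Ω) : MeasurableSpace Ω :=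
  eventuallyMeasurableSpace mΩ (ae P)

/-- The completion is the σ-field generated by the measurable sets and the sets of outer measure
zero (in Mathlib, `P N` is the outer measure of `N` when `N` is not measurable). -/
theorem completionField_eq_generateFrom (P : Measure Ω) :
    completionField P = MeasurableSpace.generateFrom ({s | MeasurableSet s} ∪ {N | P N = 0}) := by
  apply le_antisymm
  · rintro s ⟨t, ht, hst⟩
    have h1 : P (s \ t) = 0 := (ae_eq_set.1 hst).1
    have h2 : P (t \ s) = 0 := (ae_eq_set.1 hst).2
    have hs : s = (t \ (t \ s)) ∪ (s \ t) := by
      ext x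
      by_cases hx : x ∈ t <;> simp [hx]
    rw [hs]
    refine MeasurableSet.union (MeasurableSet.diff ?_ ?_) ?_
    · exact MeasurableSpace.measurableSet_generateFrom (Or.inl ht)
    · exact MeasurableSpace.measurableSet_generateFrom (Or.inr h2)
    · exact MeasurableSpace.measurableSet_generateFrom (Or.inr h1)
  · refine MeasurableSpace.generateFrom_le ?_
    rintro s (hs | hs)
    · exact ⟨s, hs, Filter.EventuallyEq.rfl⟩
    · exact ⟨∅, MeasurableSet.empty, ae_eq_empty.2 hs⟩

variable (mΩ) in
/-- The universal completion of a σ-field: the intersection of its completions with respect to all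
probability measures. -/
abbrev universalCompletion : MeasurableSpace Ω :=
  ⨅ (P : Measure Ω) (_ : IsProbabilityMeasure P), completionField P

theorem measurableSet_universalCompletion_iff {s : Set Ω} :
    MeasurableSet[universalCompletion mΩ] s ↔
      ∀ P : Measure Ω, IsProbabilityMeasure P → NullMeasurableSet s P := by
  unfold universalCompletion
  simp_rw [MeasurableSpace.measurableSet_iInf]
  rfl

end Completion

section Optimization

variable {Ω : Type u} {E : Type v}

/-- The projection `π_Ω(A)` of `A ⊆ Ω × E`. -/
def projΩ (A : Set (Ω × E)) : Set Ω := {ω | ∃ x : E, (ω, x) ∈ A}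

/-- The supremum function `g(ω) = sup {f(ω, x) : (ω, x) ∈ A}`; it is `-∞` when the section of `A`
at `ω` is empty. -/
noncomputable def supFun (A : Set (Ω × E)) (f : Ω × E → EReal) (ω : Ω) : EReal :=
  sSup {y | ∃ x : E, (ω, x) ∈ A ∧ f (ω, x) = y}

open Classical in
/-- The level `g^ε = (g - ε) 1_{g < ∞} + (1/ε) 1_{g = ∞}`. -/
noncomputable def supFunEps (A : Set (Ω × E)) (f : Ω × E → EReal) (ε : ℝ) (ω : Ω) : EReal :=
  if supFun A f ω = ⊤ then ((1 / ε : ℝ) : EReal) else supFun A f ω - (ε : EReal)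

/-- The expectation `E[X] = E[X⁺] - E[X⁻]` of an extended real random variable, with the convention
`∞ - ∞ = -∞` (which is the one of `EReal`). -/
noncomputable def extExpectation [MeasurableSpace Ω] (P : Measure Ω) (X : Ω → EReal) : EReal :=
  ((∫⁻ ω, (X ω).toENNReal ∂P : ℝ≥0∞) : EReal) - ((∫⁻ ω, (-X ω).toENNReal ∂P : ℝ≥0∞) : EReal)

end Optimization

/-! Since `{g > c}` is the projection of `A ∩ {f > c}`, part (i) rests on measurable projection and
selection. A measurable `A` involves only countably many measurable subsets of `Ω`, so it is the
pullback of a Borel set `B` in `(ℕ → ℕ) × E`. If nonempty, `B` is a continuous image of the Baire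
space, so its projection is analytic, hence universally measurable by compact inner approximation.
Greedily choosing least digits inverts the parametrization measurably, which gives a selector
(`measurableSet_projΩ_and_exists_measurable_selector`). For `ε`-optimality, selectors of `A ∩ {f >
q}` are glued over rationals `q` with `g^ε ≤ q < g`. For (ii), universally measurable selectors
agree `P`-a.e. with measurable ones, and `ε → 0` in `extExpectation_le_of_forall_exists`. -/

open Filter Topology

/-! ### Universal measurability of analytic sets -/

section Analytic

theorem isCompact_setOf_forall_le (N : ℕ → ℕ) : IsCompact {z : ℕ → ℕ | ∀ i, z i ≤ N i} := by
  have : {z : ℕ → ℕ | ∀ i, z i ≤ N i} = Set.pi univ fun i => Set.Iic (N i) := by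
    ext z
    simp only [mem_univ_pi, mem_Iic]
    rfl
  rw [this]
  exact isCompact_univ_pi fun i => (Set.finite_Iic (N i)).isCompact

/-- An open subset of the Baire space that contains the compact box `∏ [0, N i]` contains one of the
sets `{z | ∀ i < n, z i ≤ N i}`. -/
theorem exists_initial_box_subset_of_isOpen (N : ℕ → ℕ) {U : Set (ℕ → ℕ)} (hU : IsOpen U)
    (h : {z : ℕ → ℕ | ∀ i, z i ≤ N i} ⊆ U) :
    ∃ n, {z : ℕ → ℕ | ∀ i < n, z i ≤ N i} ⊆ U := by
  have hK := isCompact_setOf_forall_le N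
  let W : ℕ → Set (ℕ → ℕ) := fun n => {z | PiNat.cylinder z n ⊆ U}
  have hWmono : Monotone W := fun m n hmn z hz => (PiNat.cylinder_anti z hmn).trans hz
  have hWo : ∀ n, IsOpen (W n) := fun n => by
    refine isOpen_iff_mem_nhds.2 fun z hz => ?_
    refine mem_of_superset ((PiNat.isOpen_cylinder _ z n).mem_nhds (PiNat.self_mem_cylinder z n)) ?_
    intro w hw
    change PiNat.cylinder w n ⊆ U
    rw [PiNat.mem_cylinder_iff_eq.1 hw]
    exact hz
  have hcov : {z : ℕ → ℕ | ∀ i, z i ≤ N i} ⊆ ⋃ n, W n := fun z hz => by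
    obtain ⟨_, ⟨x, n, rfl⟩, hzV, hVU⟩ :=
      (PiNat.isTopologicalBasis_cylinders (fun _ : ℕ => ℕ)).exists_subset_of_mem_open (h hz) hU
    refine mem_iUnion.2 ⟨n, ?_⟩
    change PiNat.cylinder z n ⊆ U
    rw [PiNat.mem_cylinder_iff_eq.1 hzV]
    exact hVU
  obtain ⟨n, hn⟩ := hK.elim_directed_cover W hWo hcov hWmono.directed_le
  refine ⟨n, fun z hz => ?_⟩
  -- Truncating `z` by `N` lands in the box without changing its first `n` digits.
  have hmin : (fun i => min (z i) (N i)) ∈ W n := hn fun i => min_le_right _ _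
  exact hmin fun i hi => (min_eq_left (hz i hi)).symm

/-- Inner regularity of a finite measure on analytic sets, with respect to compact sets. -/
theorem exists_isCompact_subset_range_le_measure {Y : Type*} [TopologicalSpace Y]
    [MeasurableSpace Y] (P : Measure Y) [P.OuterRegular]
    {u : (ℕ → ℕ) → Y} (hu : Continuous u) {a : ℝ≥0∞} (ha : a < P (range u)) :
    ∃ K ⊆ range u, IsCompact K ∧ a ≤ P K := by
  -- Bound one digit at a time: continuity from below along increasing unions holds for the outer
  -- measure, so the images need not be measurable.
  have step : ∀ s : Set (ℕ → ℕ), a < P (u '' s) → ∀ n, ∃ k, a < P (u '' (s ∩ {z | z n ≤ k})) := by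
    intro s hs n
    have hmono : Monotone fun k : ℕ => u '' (s ∩ {z | z n ≤ k}) := fun k l hkl =>
      image_mono (inter_subset_inter_right _ fun z (hz : z n ≤ k) => le_trans hz hkl)
    have hun : u '' s = ⋃ k : ℕ, u '' (s ∩ {z | z n ≤ k}) := by
      rw [← image_iUnion, ← inter_iUnion]
      congr 1
      refine (inter_eq_left.2 fun z _ => mem_iUnion.2 ⟨z n, le_refl (z n)⟩).symm
    rw [hun, hmono.measure_iUnion] at hs
    exact lt_iSup_iff.1 hs
  choose! k hk using step
  let S : ℕ → Set (ℕ → ℕ) := fun n => Nat.rec univ (fun n s => s ∩ {z | z n ≤ k s n}) n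
  have hS : ∀ n, a < P (u '' S n) := by
    intro n
    induction n with
    | zero => simpa [S] using ha
    | succ n ih => exact hk (S n) ih n
  let N : ℕ → ℕ := fun n => k (S n) n
  have hSN : ∀ n, S n = {z | ∀ i < n, z i ≤ N i} := by
    intro n
    induction n with
    | zero => simp [S]
    | succ n ih =>
      change S n ∩ {z | z n ≤ N n} = _
      rw [ih]
      ext z
      simp only [mem_inter_iff, mem_ofPred_eq, Nat.lt_succ_iff_lt_or_eq]
      constructor
      · rintro ⟨h1, h2⟩ i (hi | rfl)
        exacts [h1 i hi, h2]
      · exact fun h => ⟨fun i hi => h i (Or.inl hi), h n (Or.inr rfl)⟩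
  have hK := isCompact_setOf_forall_le N
  refine ⟨u '' {z | ∀ i, z i ≤ N i}, image_subset_range _ _, hK.image hu, ?_⟩
  -- By outer regularity it suffices to bound open `V` around the image of the box; the preimage of
  -- such a `V` already contains some `S n`.
  rw [Set.measure_eq_iInf_isOpen]
  refine le_iInf₂ fun V hV => le_iInf fun hVo => ?_
  obtain ⟨n, hn⟩ := exists_initial_box_subset_of_isOpen N (hVo.preimage hu) (image_subset_iff.1 hV)
  rw [← hSN] at hn
  exact (hS n).le.trans (measure_mono (image_subset_iff.2 hn))

variable {Y : Type*} [TopologicalSpace Y] [MeasurableSpace Y] [BorelSpace Y]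

/-- Analytic sets are universally measurable. -/
theorem MeasureTheory.AnalyticSet.nullMeasurableSet [T2Space Y] {s : Set Y} (hs : AnalyticSet s)
    (P : Measure Y) [IsFiniteMeasure P] [P.OuterRegular] : NullMeasurableSet s P := by
  rw [AnalyticSet] at hs
  obtain rfl | ⟨u, hu, rfl⟩ := hs
  · exact MeasurableSet.empty.nullMeasurableSet
  rcases eq_or_ne (P (range u)) 0 with h0 | h0
  · exact NullMeasurableSet.of_null h0
  obtain ⟨a, -, halt, hatend⟩ := exists_seq_strictMono_tendsto' (pos_iff_ne_zero.2 h0)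
  choose K hKs hKc hKa using fun n =>
    exists_isCompact_subset_range_le_measure P hu (halt n).2
  have hM : MeasurableSet (⋃ n, K n) := MeasurableSet.iUnion fun n => (hKc n).measurableSet
  have hMs : (⋃ n, K n) ⊆ range u := iUnion_subset hKs
  have hle : P (range u) ≤ P (⋃ n, K n) :=
    le_of_tendsto' hatend fun n => (hKa n).trans (measure_mono (subset_iUnion K n))
  have h1 : (⋃ n, K n) =ᵐ[P] toMeasurable P (range u) :=
    ae_eq_of_subset_of_measure_ge (hMs.trans (subset_toMeasurable _ _))
      (by rwa [measure_toMeasurable]) hM.nullMeasurableSet (measure_ne_top _ _)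
  refine ⟨⋃ n, K n, hM, ?_⟩
  refine Filter.EventuallyLE.antisymm ?_ hMs.eventuallyLE
  exact (subset_toMeasurable P (range u)).eventuallyLE.trans h1.symm.le

theorem MeasureTheory.AnalyticSet.measurableSet_universalCompletion [T2Space Y]
    [TopologicalSpace.PseudoMetrizableSpace Y] {s : Set Y} (hs : AnalyticSet s) :
    MeasurableSet[universalCompletion ‹MeasurableSpace Y›] s :=
  measurableSet_universalCompletion_iff.2 fun P _ => hs.nullMeasurableSet P

end Analytic

/-! ### Measurable projection and selection -/

section Selection

/-- A continuous map on the Baire space has a right inverse on its range that is measurable for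
every σ-field containing the images of the cylinders. -/
theorem Continuous.exists_measurable_rightInverse_on_range {Y : Type*} [TopologicalSpace Y]
    [T1Space Y] [MeasurableSpace Y] {u : (ℕ → ℕ) → Y} (hu : Continuous u)
    (hm : ∀ l : List ℕ, MeasurableSet (u '' {z | PiNat.res z l.length = l})) :
    ∃ a : Y → ℕ → ℕ, Measurable a ∧ ∀ y ∈ range u, u (a y) = y := by
  classical
  let T : List ℕ → Set Y := fun l => u '' {z | PiNat.res z l.length = l}
  have hex : ∀ (l : List ℕ) (y : Y), ∃ k, y ∈ T (k :: l) ∨ ∀ i, y ∉ T (i :: l) := by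
    intro l y
    by_cases h : ∃ k, y ∈ T (k :: l)
    · exact h.imp fun k hk => Or.inl hk
    · exact ⟨0, Or.inr (not_exists.1 h)⟩
  -- The least digit that keeps `y` in the image of the extended cylinder, or `0` if there is none.
  -- Prefixes are lists with the latest digit first, as in `PiNat.res`.
  let G : List ℕ → Y → ℕ := fun l y => Nat.find (hex l y)
  have hG : ∀ l, Measurable (G l) := by
    intro l
    refine measurable_find (hex l) fun k => ?_
    refine (hm (k :: l)).union ?_
    have : {y | ∀ i, y ∉ T (i :: l)} = ⋂ i, (T (i :: l))ᶜ := by ext; simp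
    change MeasurableSet {y | ∀ i, y ∉ T (i :: l)}
    rw [this]
    exact MeasurableSet.iInter fun i => (hm (i :: l)).compl
  let F : ℕ → Y → List ℕ := fun n y => Nat.rec [] (fun _ l => G l y :: l) n
  let _ : MeasurableSpace (List ℕ) := ⊤
  have hGF : ∀ n, Measurable (F n) → Measurable fun y => G (F n y) y := fun n hn => by
    have h2 : Measurable fun p : List ℕ × Y => G p.1 p.2 :=
      measurable_from_prod_countable_right hG
    exact h2.comp (hn.prodMk measurable_id)
  have hF : ∀ n, Measurable (F n) := by
    intro n
    induction n with
    | zero => exact measurable_const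
    | succ n ih =>
      have h2 : Measurable fun p : ℕ × List ℕ => p.1 :: p.2 := measurable_of_countable _
      exact h2.comp ((hGF n ih).prodMk ih)
  let a : Y → ℕ → ℕ := fun y n => G (F n y) y
  have hres : ∀ y n, PiNat.res (a y) n = F n y := by
    intro y n
    induction n with
    | zero => rfl
    | succ n ih => rw [PiNat.res_succ, ih]
  refine ⟨a, measurable_pi_lambda _ fun n => hGF n (hF n), fun y hy => ?_⟩
  have hT : ∀ n, y ∈ T (F n y) := by
    intro n
    induction n with
    | zero =>
      obtain ⟨z, rfl⟩ := hy
      exact ⟨z, rfl, rfl⟩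
    | succ n ih =>
      have := Nat.find_spec (hex (F n y) y)
      refine this.resolve_right fun hno => ?_
      obtain ⟨z, hz, rfl⟩ := ih
      refine hno (z (F n (u z)).length) ⟨z, ?_, rfl⟩
      change PiNat.res z ((F n (u z)).length + 1) = _
      rw [PiNat.res_succ]
      exact congrArg _ hz
  choose z hz hzy using hT
  have hcyl : ∀ n, ∀ i < n, z n i = a y i := by
    intro n
    have h1 : PiNat.res (z n) n = PiNat.res (a y) n := by
      have h2 := hz n
      have h3 : (F n y).length = n := by rw [← hres, PiNat.res_length]
      change PiNat.res (z n) (F n y).length = F n y at h2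
      rw [h3] at h2
      rw [h2, hres]
    exact fun i hi => PiNat.res_eq_res.1 h1 hi
  have hlim : Tendsto z atTop (𝓝 (a y)) := by
    refine tendsto_pi_nhds.2 fun i => tendsto_const_nhds.congr' ?_
    filter_upwards [eventually_gt_atTop i] with n hn using (hcyl n i hn).symm
  have h1 : Tendsto (fun n => u (z n)) atTop (𝓝 (u (a y))) := (hu.tendsto _).comp hlim
  simp only [hzy] at h1
  exact (tendsto_const_nhds_iff.1 h1).symm

variable {Ω : Type u} [mΩ : MeasurableSpace Ω] {E : Type v} [MeasurableSpace E]

/-- Null-measurability for `P.map φ` pulls back to null-measurability for `P`. -/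
theorem Measurable.measurable_universalCompletion {Y : Type*} [mY : MeasurableSpace Y] {φ : Ω → Y}
    (hφ : Measurable φ) : Measurable[universalCompletion mΩ, universalCompletion mY] φ := by
  intro s hs
  rw [measurableSet_universalCompletion_iff] at hs ⊢
  intro P hP
  exact (hs (P.map φ) (Measure.isProbabilityMeasure_map hφ.aemeasurable)).preimage
    ⟨hφ, Measure.AbsolutelyContinuous.rfl⟩

/-- A measurable subset of a product only depends on countably many measurable subsets of the first
factor. -/
theorem MeasurableSet.exists_eq_preimage_prodMap {A : Set (Ω × E)} (hA : MeasurableSet A) :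
    ∃ (φ : Ω → ℕ → ℕ) (B : Set ((ℕ → ℕ) × E)), Measurable φ ∧ MeasurableSet B ∧
      A = Prod.map φ id ⁻¹' B := by
  classical
  induction A, hA using MeasurableSpace.induction_on_inter generateFrom_prod.symm isPiSystem_prod with
  | empty => exact ⟨fun _ _ => 0, ∅, measurable_const, MeasurableSet.empty, rfl⟩
  | basic t ht =>
    obtain ⟨s, hs, r, hr, rfl⟩ := ht
    refine ⟨fun ω _ => if ω ∈ s then 1 else 0, {y | y 0 = 1} ×ˢ r, ?_, ?_, ?_⟩
    · exact measurable_pi_lambda _ fun _ => Measurable.ite hs measurable_const measurable_const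
    · exact (measurableSet_eq_fun (measurable_pi_apply 0) measurable_const).prod hr
    · ext ⟨ω, x⟩; simp
  | compl t _ ih =>
    obtain ⟨φ, B, hφ, hB, rfl⟩ := ih
    exact ⟨φ, Bᶜ, hφ, hB.compl, rfl⟩
  | iUnion t _ _ ih =>
    choose φ B hφ hB ht using ih
    -- The pairing function packs the whole sequence of maps `φ n` into a single one.
    refine ⟨fun ω k => φ k.unpair.1 ω k.unpair.2,
      ⋃ n, Prod.map (fun y j => y (Nat.pair n j)) id ⁻¹' B n, ?_, ?_, ?_⟩
    · exact measurable_pi_lambda _ fun k => (measurable_pi_apply _).comp (hφ _)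
    · refine MeasurableSet.iUnion fun n => ?_
      have : Measurable fun (y : ℕ → ℕ) j => y (Nat.pair n j) :=
        measurable_pi_lambda _ fun j => measurable_pi_apply _
      exact (this.prodMap measurable_id) (hB n)
    · ext ⟨ω, x⟩
      simp [ht]

/-- **Measurable projection and selection theorem**: the projection of a measurable set along a
standard Borel space is universally measurable, and the set has a universally measurable
selector. -/
theorem measurableSet_projΩ_and_exists_measurable_selector [StandardBorelSpace E] [Nonempty E]
    {A : Set (Ω × E)} (hA : MeasurableSet A) :
    MeasurableSet[universalCompletion mΩ] (projΩ A) ∧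
      ∃ Z : Ω → E, Measurable[universalCompletion mΩ] Z ∧ ∀ ω ∈ projΩ A, (ω, Z ω) ∈ A := by
  obtain ⟨φ, B, hφ, hB, rfl⟩ := hA.exists_eq_preimage_prodMap
  let _ := upgradeStandardBorel E
  have hBan := hB.analyticSet
  rw [AnalyticSet] at hBan
  obtain rfl | ⟨h, hh, rfl⟩ := hBan
  · have : projΩ (Prod.map φ (id : E → E) ⁻¹' ∅) = ∅ := by ext; simp [projΩ]
    rw [this]
    exact ⟨@MeasurableSet.empty _ (universalCompletion mΩ),
      fun _ => Classical.arbitrary E, @measurable_const _ _ _ (universalCompletion mΩ) _, by simp⟩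
  have hu : Continuous fun z => (h z).1 := continuous_fst.comp hh
  have hpr : projΩ (Prod.map φ id ⁻¹' range h) = φ ⁻¹' range fun z => (h z).1 := by
    ext ω
    constructor
    · rintro ⟨x, z, hz⟩
      exact ⟨z, by simp [hz]⟩
    · rintro ⟨z, hz⟩
      exact ⟨(h z).2, z, Prod.ext hz rfl⟩
  obtain ⟨a, ha, hau⟩ := @Continuous.exists_measurable_rightInverse_on_range _ _ _
    (universalCompletion inferInstance) _ hu fun l => by
      refine AnalyticSet.measurableSet_universalCompletion ?_
      refine IsOpen.analyticSet_image ?_ hu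
      refine isOpen_iff_mem_nhds.2 fun z hz => ?_
      refine mem_of_superset ((PiNat.isOpen_cylinder _ z l.length).mem_nhds
        (PiNat.self_mem_cylinder z _)) ?_
      rw [PiNat.cylinder_eq_res]
      exact fun w (hw : PiNat.res w l.length = _) => hw.trans hz
  refine ⟨?_, fun ω => (h (a (φ ω))).2, ?_, ?_⟩
  · rw [hpr]
    exact hφ.measurable_universalCompletion
      (analyticSet_range_of_polishSpace hu).measurableSet_universalCompletion
  · exact (continuous_snd.comp hh).measurable.comp (ha.comp hφ.measurable_universalCompletion)
  · intro ω hω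
    rw [hpr] at hω
    exact ⟨a (φ ω), Prod.ext (hau _ hω) rfl⟩

end Selection

/-! ### Borel spaces as standard Borel spaces -/

theorem MeasurableEquiv.standardBorelSpace {α β : Type*} [MeasurableSpace α] [MeasurableSpace β]
    [StandardBorelSpace β] (e : α ≃ᵐ β) : StandardBorelSpace α := by
  obtain ⟨τ, _, _⟩ := StandardBorelSpace.polish (α := β)
  let t : TopologicalSpace α := TopologicalSpace.induced e inferInstance
  have hemb : Topology.IsClosedEmbedding e :=
    ⟨⟨⟨rfl⟩, e.injective⟩, by rw [e.surjective.range_eq]; exact isClosed_univ⟩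
  have hpol : PolishSpace α := hemb.polishSpace
  have hborel : BorelSpace α := by
    constructor
    exact e.measurableEmbedding.comap_eq.symm.trans
      ((congrArg (MeasurableSpace.comap e) ‹BorelSpace β›.measurable_eq).trans borel_comap.symm)
  infer_instance

theorem IsBorelTopSpace.standardBorelSpace {E : Type v} [TopologicalSpace E] [MeasurableSpace E]
    [BorelSpace E] (hE : IsBorelTopSpace E) : StandardBorelSpace E := by
  obtain ⟨X, _, _, s, hs, ⟨e⟩⟩ := hE
  borelize X
  have := hs.standardBorel
  exact e.toMeasurableEquiv.standardBorelSpace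

/-! ### The supremum function and near-optimal selectors -/

section Optimization

variable {Ω : Type u} {E : Type v}

theorem projΩ_inter_Ioi_eq (A : Set (Ω × E)) (f : Ω × E → EReal) (c : EReal) :
    projΩ (A ∩ f ⁻¹' Ioi c) = supFun A f ⁻¹' Ioi c := by
  ext ω
  simp only [projΩ, supFun, mem_preimage, mem_Ioi, lt_sSup_iff]
  constructor
  · rintro ⟨x, hx, hc⟩
    exact ⟨_, ⟨x, hx, rfl⟩, hc⟩
  · rintro ⟨_, ⟨x, hx, rfl⟩, hc⟩
    exact ⟨x, hx, hc⟩

theorem le_supFun {A : Set (Ω × E)} (f : Ω × E → EReal) {ω : Ω} {x : E} (h : (ω, x) ∈ A) :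
    f (ω, x) ≤ supFun A f ω :=
  le_sSup ⟨x, h, rfl⟩

theorem supFunEps_lt_supFun {A : Set (Ω × E)} {f : Ω × E → EReal} {ε : ℝ} (hε : 0 < ε) {ω : Ω}
    (h : supFun A f ω ≠ ⊥) : supFunEps A f ε ω < supFun A f ω := by
  unfold supFunEps
  split_ifs with ht
  · rw [ht]
    exact EReal.coe_lt_top _
  · lift supFun A f ω to ℝ using ⟨ht, h⟩ with r
    exact_mod_cast sub_lt_self r hε

variable [mΩ : MeasurableSpace Ω] [MeasurableSpace E] [StandardBorelSpace E] [Nonempty E]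

theorem measurable_supFun {A : Set (Ω × E)} (hA : MeasurableSet A) {f : Ω × E → EReal}
    (hf : Measurable f) : Measurable[universalCompletion mΩ] (supFun A f) := by
  refine @measurable_of_Ioi _ _ _ _ _ (universalCompletion mΩ) _ _ _ _ fun c => ?_
  rw [← projΩ_inter_Ioi_eq]
  exact (measurableSet_projΩ_and_exists_measurable_selector
    (hA.inter (hf measurableSet_Ioi))).1

theorem measurable_supFunEps {A : Set (Ω × E)} (hA : MeasurableSet A) {f : Ω × E → EReal}
    (hf : Measurable f) (ε : ℝ) : Measurable[universalCompletion mΩ] (supFunEps A f ε) := by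
  classical
  have hg := measurable_supFun hA hf
  have hmono : Monotone fun x : EReal => x - (ε : EReal) := fun x y h => EReal.sub_le_sub h le_rfl
  have h1 : Measurable fun x : EReal => if x = ⊤ then ((1 / ε : ℝ) : EReal) else x - (ε : EReal) :=
    Measurable.ite (measurableSet_singleton ⊤) measurable_const hmono.measurable
  convert! h1.comp hg using 1

/-- Existence of a universally measurable `ε`-optimal selector. -/
theorem exists_measurable_selector_supFunEps_le {A : Set (Ω × E)} (hA : MeasurableSet A)
    {f : Ω × E → EReal} (hf : Measurable f) {ε : ℝ} (hε : 0 < ε) :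
    ∃ Z : Ω → E, Measurable[universalCompletion mΩ] Z ∧
      ∀ ω ∈ projΩ A, (ω, Z ω) ∈ A ∧ supFunEps A f ε ω ≤ f (ω, Z ω) := by
  classical
  obtain ⟨Z₀, hZ₀, hZ₀A⟩ := (measurableSet_projΩ_and_exists_measurable_selector hA).2
  have hAq : ∀ q : ℚ, MeasurableSet (A ∩ f ⁻¹' Ioi ((q : ℝ) : EReal)) := fun q =>
    hA.inter (hf measurableSet_Ioi)
  choose Z hZ hZA using fun q : ℚ => (measurableSet_projΩ_and_exists_measurable_selector (hAq q)).2
  let D : ℚ → Set Ω := fun q =>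
    projΩ (A ∩ f ⁻¹' Ioi ((q : ℝ) : EReal)) ∩ supFunEps A f ε ⁻¹' Iic ((q : ℝ) : EReal)
  have hD : ∀ q, MeasurableSet[universalCompletion mΩ] (D q) := fun q =>
    @MeasurableSet.inter _ (universalCompletion mΩ) _ _
      (measurableSet_projΩ_and_exists_measurable_selector (hAq q)).1
      (measurable_supFunEps hA hf ε measurableSet_Iic)
  let e : ℕ → ℚ := (Denumerable.eqv ℚ).symm
  have hdisj := disjoint_disjointed fun n => D (e n)
  obtain ⟨W, hW, hWe⟩ := @exists_measurable_piecewise _ _ (universalCompletion mΩ) _ _ _ _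
    (disjointed fun n => D (e n))
    (@MeasurableSet.disjointed _ (universalCompletion mΩ) _ fun n => hD (e n))
    (fun n => Z (e n)) (fun n => hZ (e n)) fun i j hij => by
      intro x hx
      exact (disjoint_left.1 (hdisj hij) hx.1 hx.2).elim
  refine ⟨fun ω => if ω ∈ ⋃ q, D q then W ω else Z₀ ω,
    @Measurable.ite _ _ _ _ (universalCompletion mΩ) _ (· ∈ ⋃ q, D q) _
      (@MeasurableSet.iUnion _ _ (universalCompletion mΩ) _ D hD) hW hZ₀, fun ω hω => ?_⟩
  beta_reduce
  by_cases h : ω ∈ ⋃ q, D q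
  · rw [if_pos h]
    have h' : ω ∈ ⋃ n, disjointed (fun n => D (e n)) n := by
      rw [iUnion_disjointed, (Denumerable.eqv ℚ).symm.surjective.iUnion_comp D]
      exact h
    obtain ⟨n, hn⟩ := mem_iUnion.1 h'
    have hDn := disjointed_subset (fun n => D (e n)) n hn
    rw [hWe n hn]
    have h2 := hZA (e n) ω hDn.1
    exact ⟨h2.1, le_trans hDn.2 (le_of_lt h2.2)⟩
  · rw [if_neg h]
    refine ⟨hZ₀A ω hω, ?_⟩
    -- Unless `g = -∞`, a rational fits between `g^ε` and `g`. If `g = -∞`, then `g^ε = -∞` and any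
    -- selector will do.
    have hbot : supFun A f ω = ⊥ := by
      by_contra hne
      obtain ⟨q, hq1, hq2⟩ := EReal.exists_rat_btwn_of_lt (supFunEps_lt_supFun hε hne)
      refine h (mem_iUnion.2 ⟨q, ?_, hq1.le⟩)
      rw [projΩ_inter_Ioi_eq]
      exact hq2
    simp [supFunEps, hbot]

end Optimization

/-! ### Interchange of supremum and expectation -/

section Expectation

variable {Ω : Type u} [mΩ : MeasurableSpace Ω] {E : Type v}

theorem extExpectation_mono_ae {P : Measure Ω} {X Y : Ω → EReal} (h : X ≤ᵐ[P] Y) :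
    extExpectation P X ≤ extExpectation P Y := by
  refine EReal.sub_le_sub ?_ ?_
  · refine EReal.coe_ennreal_le_coe_ennreal_iff.2 (lintegral_mono_ae ?_)
    filter_upwards [h] with ω hω using EReal.toENNReal_le_toENNReal hω
  · refine EReal.coe_ennreal_le_coe_ennreal_iff.2 (lintegral_mono_ae ?_)
    filter_upwards [h] with ω hω using EReal.toENNReal_le_toENNReal (EReal.neg_le_neg_iff.2 hω)

theorem aemeasurable_of_measurable_universalCompletion {β : Type*} [MeasurableSpace β]
    [MeasurableSpace.CountablyGenerated β] {Z : Ω → β} (hZ : Measurable[universalCompletion mΩ] Z)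
    (P : Measure Ω) [IsProbabilityMeasure P] : AEMeasurable Z P :=
  NullMeasurable.aemeasurable fun _ hs =>
    measurableSet_universalCompletion_iff.1 (hZ hs) P inferInstance

/-- If `X` can be approximated from below as in the definition of `supFunEps` by random variables
whose expectations are at most `S`, then the expectation of `X` is at most `S`. -/
theorem extExpectation_le_of_forall_exists {P : Measure Ω} [IsProbabilityMeasure P]
    {X : Ω → EReal} (hX : AEMeasurable X P) {S : EReal}
    (h : ∀ ε : ℝ, 0 < ε → ∃ Y : Ω → EReal, AEMeasurable Y P ∧ extExpectation P Y ≤ S ∧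
      ∀ᵐ ω ∂P, (if X ω = ⊤ then ((1 / ε : ℝ) : EReal) else X ω - (ε : EReal)) ≤ Y ω) :
    extExpectation P X ≤ S := by
  set J : ℝ≥0∞ := ∫⁻ ω, (-X ω).toENNReal ∂P with hJ
  rcases eq_or_ne J ∞ with hJt | hJt
  · rw [extExpectation, ← hJ, hJt]
    simp
  -- With this choice `1 / ε n ≥ n`, so where `X = ∞` the bound on `Y` dominates `X` truncated at
  -- `n`. The positive and negative parts each cost one `ε n`.
  let ε : ℕ → ℝ := fun n => 1 / ((n : ℝ) + 1)
  have hε : ∀ n, 0 < ε n := fun n => Nat.one_div_pos_of_nat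
  have key : ∀ n : ℕ, ((∫⁻ ω, min (X ω).toENNReal n ∂P : ℝ≥0∞) : EReal) ≤
      S + ((J + ENNReal.ofReal (ε n) + ENNReal.ofReal (ε n) : ℝ≥0∞) : EReal) := by
    intro n
    obtain ⟨Y, hY, hYS, hXY⟩ := h (ε n) (hε n)
    have hneg : ∫⁻ ω, (-Y ω).toENNReal ∂P ≤ J + ENNReal.ofReal (ε n) := by
      calc ∫⁻ ω, (-Y ω).toENNReal ∂P
          ≤ ∫⁻ ω, (-X ω).toENNReal + ENNReal.ofReal (ε n) ∂P := by
            refine lintegral_mono_ae ?_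
            filter_upwards [hXY] with ω hω
            split_ifs at hω with ht
            · have h0 : (0 : EReal) ≤ Y ω := le_trans (by exact_mod_cast (one_div_pos.2 (hε n)).le) hω
              rw [EReal.toENNReal_of_nonpos (by simpa using h0)]
              exact zero_le
            · rw [← EReal.real_coe_toENNReal]
              refine le_trans (EReal.toENNReal_le_toENNReal ?_) EReal.toENNReal_add_le
              rw [← EReal.neg_le_neg_iff] at hω
              refine hω.trans (le_of_eq ?_)
              rw [EReal.neg_sub (Or.inr (EReal.coe_ne_bot _)) (Or.inr (EReal.coe_ne_top _))]
        _ = J + ENNReal.ofReal (ε n) := by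
            rw [lintegral_add_right _ measurable_const]
            simp [hJ]
    have hpos : ∫⁻ ω, min (X ω).toENNReal n ∂P ≤
        (∫⁻ ω, (Y ω).toENNReal ∂P) + ENNReal.ofReal (ε n) := by
      calc ∫⁻ ω, min (X ω).toENNReal n ∂P
          ≤ ∫⁻ ω, (Y ω).toENNReal + ENNReal.ofReal (ε n) ∂P := by
            refine lintegral_mono_ae ?_
            filter_upwards [hXY] with ω hω
            split_ifs at hω with ht
            · refine le_trans (min_le_right _ _) (le_add_right ?_)
              refine le_trans ?_ (EReal.toENNReal_le_toENNReal hω)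
              rw [EReal.real_coe_toENNReal, ← ENNReal.ofReal_natCast]
              refine ENNReal.ofReal_le_ofReal ?_
              simp [ε]
            · refine le_trans (min_le_left _ _) ?_
              rw [← EReal.real_coe_toENNReal]
              refine le_trans (EReal.toENNReal_le_toENNReal ?_) EReal.toENNReal_add_le
              exact (EReal.sub_le_iff_le_add (Or.inl (EReal.coe_ne_bot _))
                (Or.inl (EReal.coe_ne_top _))).1 hω
        _ = _ := by
            rw [lintegral_add_right _ measurable_const]
            simp
    have hfin : ∫⁻ ω, (-Y ω).toENNReal ∂P ≠ ∞ :=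
      ne_top_of_le_ne_top (ENNReal.add_ne_top.2 ⟨hJt, ENNReal.ofReal_ne_top⟩) hneg
    have hYp : ((∫⁻ ω, (Y ω).toENNReal ∂P : ℝ≥0∞) : EReal) ≤
        S + ((J + ENNReal.ofReal (ε n) : ℝ≥0∞) : EReal) := by
      refine le_trans ((EReal.sub_le_iff_le_add (Or.inl ?_) (Or.inl ?_)).1 hYS) ?_
      · exact EReal.coe_ennreal_ne_bot _
      · simpa using hfin
      · exact add_le_add le_rfl (EReal.coe_ennreal_le_coe_ennreal_iff.2 hneg)
    calc _ ≤ (((∫⁻ ω, (Y ω).toENNReal ∂P) + ENNReal.ofReal (ε n) : ℝ≥0∞) : EReal) :=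
          EReal.coe_ennreal_le_coe_ennreal_iff.2 hpos
      _ ≤ _ := by
          rw [EReal.coe_ennreal_add, EReal.coe_ennreal_add _ (ENNReal.ofReal (ε n)), ← add_assoc]
          exact add_le_add hYp le_rfl
  have hε0 : Tendsto (fun n => ENNReal.ofReal (ε n)) atTop (𝓝 0) := by
    simpa [ε] using ENNReal.tendsto_ofReal tendsto_one_div_add_atTop_nhds_zero_nat
  have hlimJ : Tendsto
      (fun n => S + ((J + ENNReal.ofReal (ε n) + ENNReal.ofReal (ε n) : ℝ≥0∞) : EReal)) atTop
      (𝓝 (S + (J : EReal))) := by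
    have h1 : Tendsto (fun n => J + ENNReal.ofReal (ε n) + ENNReal.ofReal (ε n)) atTop (𝓝 J) := by
      simpa using (tendsto_const_nhds.add hε0).add hε0
    have h2 := (continuous_coe_ennreal_ereal.tendsto J).comp h1
    have h3 : Tendsto (fun p : EReal × EReal => p.1 + p.2) (𝓝 (S, (J : EReal)))
        (𝓝 (S + (J : EReal))) :=
      -- Finiteness of `J` makes addition continuous here, even for infinite `S`.
      EReal.continuousAt_add (Or.inr (EReal.coe_ennreal_ne_bot _)) (Or.inr (by simpa using hJt))
    exact h3.comp (tendsto_const_nhds.prodMk_nhds h2)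
  have hlimX : Tendsto (fun n : ℕ => ((∫⁻ ω, min (X ω).toENNReal n ∂P : ℝ≥0∞) : EReal)) atTop
      (𝓝 ((∫⁻ ω, (X ω).toENNReal ∂P : ℝ≥0∞) : EReal)) := by
    refine (continuous_coe_ennreal_ereal.tendsto _).comp ?_
    refine lintegral_tendsto_of_tendsto_of_monotone (fun n => ?_) ?_ ?_
    · exact (measurable_ereal_toENNReal.comp_aemeasurable hX).min aemeasurable_const
    · exact ae_of_all _ fun ω m n hmn => min_le_min le_rfl (Nat.cast_le.2 hmn)
    · refine ae_of_all _ fun ω => ?_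
      simpa using (tendsto_const_nhds (x := (X ω).toENNReal)).min ENNReal.tendsto_nat_nhds_top
  refine EReal.sub_le_of_le_add ?_
  exact le_of_tendsto_of_tendsto' hlimX hlimJ key

variable [MeasurableSpace E] [StandardBorelSpace E] [Nonempty E]

theorem extExpectation_indicator_supFun {A : Set (Ω × E)} (hA : MeasurableSet A)
    {f : Ω × E → EReal} (hf : Measurable f) (P : Measure Ω) [IsProbabilityMeasure P] :
    extExpectation P ((projΩ A).indicator (supFun A f)) =
      sSup {e : EReal | ∃ Z : Ω → E, Measurable Z ∧
        (∀ᵐ ω ∂P, ω ∈ projΩ A → (ω, Z ω) ∈ A) ∧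
        e = extExpectation P ((projΩ A).indicator fun ω => f (ω, Z ω))} := by
  classical
  have hπ : NullMeasurableSet (projΩ A) P := measurableSet_universalCompletion_iff.1
    (measurableSet_projΩ_and_exists_measurable_selector hA).1 P inferInstance
  apply le_antisymm
  · refine extExpectation_le_of_forall_exists
      ((aemeasurable_of_measurable_universalCompletion (measurable_supFun hA hf) P).indicator₀ hπ)
      fun ε hε => ?_
    obtain ⟨Z, hZ, hZA⟩ := exists_measurable_selector_supFunEps_le hA hf hε
    have hZae := aemeasurable_of_measurable_universalCompletion hZ P
    refine ⟨(projΩ A).indicator fun ω => f (ω, hZae.mk Z ω), ?_, le_sSup ?_, ?_⟩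
    · exact (hf.comp (measurable_id.prodMk hZae.measurable_mk)).aemeasurable.indicator₀ hπ
    · refine ⟨hZae.mk Z, hZae.measurable_mk, ?_, rfl⟩
      filter_upwards [hZae.ae_eq_mk] with ω hω hωA
      rw [← hω]
      exact (hZA ω hωA).1
    · filter_upwards [hZae.ae_eq_mk] with ω hω
      by_cases hωA : ω ∈ projΩ A
      · rw [indicator_of_mem hωA, indicator_of_mem hωA, ← hω]
        exact (hZA ω hωA).2
      -- Off the projection both sides come from `0`, and the claim is `-ε ≤ 0`.
      · rw [indicator_of_notMem hωA, indicator_of_notMem hωA, if_neg EReal.zero_ne_top, zero_sub]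
        simpa using hε.le
  · refine sSup_le ?_
    rintro _ ⟨Z, -, hZA, rfl⟩
    refine extExpectation_mono_ae ?_
    filter_upwards [hZA] with ω hω
    by_cases hωA : ω ∈ projΩ A
    · rw [indicator_of_mem hωA, indicator_of_mem hωA]
      exact le_supFun f (hω hωA)
    · rw [indicator_of_notMem hωA, indicator_of_notMem hωA]

end Expectation

theorem mainTheorem7 {Ω : Type u} [mΩ : MeasurableSpace Ω]
    {E : Type v} [TopologicalSpace E] [MeasurableSpace E] [BorelSpace E] [Nonempty E]
    (hE : IsBorelTopSpace E)
    (A : Set (Ω × E)) (hA : MeasurableSet A)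
    (f : Ω × E → EReal) (hf : Measurable f) :
    (Measurable[universalCompletion mΩ] (supFun A f) ∧
      MeasurableSet[universalCompletion mΩ] (projΩ A) ∧
      ∀ ε : ℝ, 0 < ε → ∃ Z : Ω → E, Measurable[universalCompletion mΩ] Z ∧
        ∀ ω ∈ projΩ A, (ω, Z ω) ∈ A ∧ supFunEps A f ε ω ≤ f (ω, Z ω)) ∧
    ∀ P : Measure Ω, IsProbabilityMeasure P →
      extExpectation P ((projΩ A).indicator (supFun A f)) =
        sSup {e : EReal | ∃ Z : Ω → E, Measurable Z ∧
          (∀ᵐ ω ∂P, ω ∈ projΩ A → (ω, Z ω) ∈ A) ∧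
          e = extExpectation P ((projΩ A).indicator fun ω => f (ω, Z ω))} := by
  have := hE.standardBorelSpace
  exact ⟨⟨measurable_supFun hA hf, (measurableSet_projΩ_and_exists_measurable_selector hA).1,
    fun ε hε => exists_measurable_selector_supFunEps_le hA hf hε⟩,
    fun P _ => extExpectation_indicator_supFun hA hf P⟩
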